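/- Let $T$ be a finite tree with $n\ge 1$ vertices and let $m\ge 0$, $t\ge 0$ be integers. The $m$-order subdivision of a graph is obtained by inserting $m$ new vertices into each edge, i.e. by replacing every edge $uv$ by a path $u\,w_1\cdots w_m\,v$ of length $m+1$ with new inner vertices. Let $T^m(0)=T$, let $T^m(s+1)$ be the $m$-order subdivision of $T^m(s)$, and write $|T^m(s)|$ for the number of vertices of $T^m(s)$. Let $W_T=\frac12\sum_{u,v\in T}d_{uv}$ be the Wiener index of $T$, where $d_{uv}$ is the graph distance. For a finite connected graph $G$ with vertex set $V$, $|V|\ge 2$, let $H_{u\to v}$ be the expected first time at which the simple random walk on $G$ started at $u$ (each step is to a uniformly chosen neighbour) is at $v$, so that $H_{u\to u}=0$, and let $$\langle H_G\rangle=\frac{1}{|V|(|V|-1)}\sum_{u,v\in V}H_{u\to v}$$ be the mean hitting time. Then $$|T^m(t)|=(n-1)(m+1)^t+1,$$ and, if $n\ge 2$, the mean hitting time of $T^m(t)$ is finite and equals $$\langle H_{T^m(t)}\rangle=\frac{2}{|T^m(t)|}\Big\{f_1^{\,t}\,W_T-g_1\sum_{i=0}^{t-1}f_1^{\,i}\,|T^m(t-1-i)|^2+h_1\sum_{i=0}^{t-1}f_1^{\,i}\,|T^m(t-1-i)|-l_1\sum_{i=0}^{t-1}f_1^{\,i}\Big\},$$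 where $f_1=(m+1)^3$, $g_1=\frac{m(m+1)^2}{2}$, $h_1=\frac{m(m+1)(2m+1)}{3}$ and $l_1=\frac{m(m^2-1)}{6}$. -/

import Mathlib

open MeasureTheory ProbabilityTheory
open scoped ENNReal

noncomputable section

namespace SubdivisionTree

universe u

/-! ### Wiener index -/

/-- Wiener index: half the sum of the distances over all ordered pairs of vertices. -/
def wienerIndex {V : Type u} [Fintype V] (G : SimpleGraph V) : ℝ :=
  (1 / 2) * ∑ x : V, ∑ y : V, (G.dist x y : ℝ)

/-! ### Simple random walk and hitting times -/

open Classical in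
/-- Law of one step of the simple random walk from `x`: uniform on the neighbours of `x`.
(At an isolated vertex, which a connected graph with two or more vertices does not have, the
walk stays put.) -/
def stepLaw {V : Type u} [Fintype V] (G : SimpleGraph V) (x : V) : PMF V :=
  if h : (G.neighborFinset x).Nonempty then PMF.uniformOfFinset (G.neighborFinset x) h
  else PMF.pure x

/-- The transition kernel of the simple random walk, as a function of the history up to time `k`:
only the position at time `k` matters. -/
def stepKernel {V : Type u} [Fintype V] [MeasurableSpace V] [DiscreteMeasurableSpace V]
    (G : SimpleGraph V) (k : ℕ) : Kernel ((i : Finset.Iic k) → (fun _ : ℕ => V) i) V where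
  toFun past := (stepLaw G (past ⟨k, Finset.mem_Iic.2 le_rfl⟩)).toMeasure
  measurable' :=
    (Measurable.of_discrete (f := fun x : V => (stepLaw G x).toMeasure)).comp
      (measurable_pi_apply _)

instance {V : Type u} [Fintype V] [MeasurableSpace V] [DiscreteMeasurableSpace V]
    (G : SimpleGraph V) (k : ℕ) : IsMarkovKernel (stepKernel G k) :=
  ⟨fun past =>
    PMF.toMeasure.isProbabilityMeasure (stepLaw G (past ⟨k, Finset.mem_Iic.2 le_rfl⟩))⟩

/-- Law on trajectories `ℕ → V` of the simple random walk on `G` started at `x`. -/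
def walkLaw {V : Type u} [Fintype V] [MeasurableSpace V] [DiscreteMeasurableSpace V]
    (G : SimpleGraph V) (x : V) : Measure (ℕ → V) :=
  Kernel.traj (X := fun _ : ℕ => V) (stepKernel G) 0 (fun _ => x)

/-- The first time at which the trajectory `ω` is at `y` (`∞` if it never is). -/
def firstHit {V : Type u} (y : V) (ω : ℕ → V) : ℝ≥0∞ :=
  ⨅ (k : ℕ) (_ : ω k = y), (k : ℝ≥0∞)

/-- Hitting time from `x` to `y`: the expectation of the first time at which the simple random
walk started at `x` is at `y`. -/
def hittingTime {V : Type u} [Fintype V] (G : SimpleGraph V) (x y : V) : ℝ≥0∞ :=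
  letI : MeasurableSpace V := ⊤
  haveI : DiscreteMeasurableSpace V := ⟨fun _ => trivial⟩
  ∫⁻ ω, firstHit y ω ∂(walkLaw G x)

/-- Mean hitting time: the average of the hitting times over all ordered pairs of distinct
vertices (the pairs `(x, x)` contribute `0`). -/
def meanHittingTime {V : Type u} [Fintype V] (G : SimpleGraph V) : ℝ≥0∞ :=
  (∑ x : V, ∑ y : V, hittingTime G x y) /
    ((Fintype.card V : ℝ≥0∞) * ((Fintype.card V : ℝ≥0∞) - 1))

/-! ### Subdivision -/

/-- Vertices of the `m`-order subdivision: the old vertices, and `m` new ones for each edge. -/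
abbrev SubdivVertex {V : Type u} (m : ℕ) (G : SimpleGraph V) : Type u :=
  V ⊕ (G.edgeSet × Fin m)

/-- The `k`-th vertex of the path `u, w₁, …, wₘ, v` that replaces the edge `e = uv`, for
`0 ≤ k ≤ m + 1`. The order in which the two endpoints `u, v` are taken is chosen arbitrarily for
each edge. -/
def edgePath {V : Type u} (m : ℕ) (G : SimpleGraph V) (e : G.edgeSet) (k : ℕ) :
    SubdivVertex m G :=
  if k = 0 then Sum.inl (Quot.out (e : Sym2 V)).1
  else if h : k - 1 < m then Sum.inr (e, ⟨k - 1, h⟩)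
  else Sum.inl (Quot.out (e : Sym2 V)).2

/-- The `m`-order subdivision of `G`: every edge is replaced by a path of length `m + 1` through
`m` new vertices. -/
def subdivision {V : Type u} (m : ℕ) (G : SimpleGraph V) : SimpleGraph (SubdivVertex m G) :=
  SimpleGraph.fromEdgeSet
    {s | ∃ e : G.edgeSet, ∃ k : ℕ, k ≤ m ∧ s = s(edgePath m G e k, edgePath m G e (k + 1))}

/-- The result of applying the `m`-order subdivision `t` times to the seed `G`, as a vertex type
together with a graph on it. -/
def iterSubdivision {V : Type u} (m : ℕ) (G : SimpleGraph V) : ℕ → Σ W : Type u, SimpleGraph W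
  | 0 => ⟨V, G⟩
  | t + 1 => ⟨SubdivVertex m (iterSubdivision m G t).2, subdivision m (iterSubdivision m G t).2⟩

/-- The vertex set of the subdivision graph after `t` steps. -/
abbrev Vert {V : Type u} (m : ℕ) (G : SimpleGraph V) (t : ℕ) : Type u :=
  (iterSubdivision m G t).1

/-- The subdivision graph after `t` steps. -/
abbrev graph {V : Type u} (m : ℕ) (G : SimpleGraph V) (t : ℕ) : SimpleGraph (Vert m G t) :=
  (iterSubdivision m G t).2

theorem finite_vert {V : Type u} [Finite V] (m : ℕ) (G : SimpleGraph V) (t : ℕ) :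
    Finite (Vert m G t) := by
  induction t with
  | zero => exact inferInstanceAs (Finite V)
  | succ t ih =>
    exact inferInstanceAs (Finite (Vert m G t ⊕ ((graph m G t).edgeSet × Fin m)))

instance {V : Type u} [Fintype V] (m : ℕ) (G : SimpleGraph V) (t : ℕ) : Fintype (Vert m G t) :=
  haveI := finite_vert m G t
  Fintype.ofFinite _

/-! ### Coefficients -/

def f₁ (m : ℕ) : ℝ := ((m : ℝ) + 1) ^ 3

def g₁ (m : ℕ) : ℝ := (m : ℝ) * ((m : ℝ) + 1) ^ 2 / 2

def h₁ (m : ℕ) : ℝ := (m : ℝ) * ((m : ℝ) + 1) * (2 * (m : ℝ) + 1) / 3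

def l₁ (m : ℕ) : ℝ := (m : ℝ) * ((m : ℝ) ^ 2 - 1) / 6

end SubdivisionTree

end

/-!
On a tree with `n` vertices the function `x ↦ ∑ z, deg z * (x | z)_y`, where `(x | z)_y` is the
Gromov product, vanishes at `y` and solves the Poisson equation elsewhere, hence is the hitting time
`H x y`. As `(x | z)_y + (y | z)_x = d x y`, the commute time of `x` and `y` is `2 (n - 1) d x y`,
and averaging gives the mean hitting time `2 W / n`.

The Wiener index of a tree is `W = ∑ e, |S e| * |(S e)ᶜ|`, where `S e` is one of the two sides of
the tree when the edge `e` is removed. After subdivision, a cut with sides of sizes `s` and `s'`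
becomes `m + 1` cuts with sides of sizes `(m + 1) s - m + k` and `(m + 1) s' - k` for `0 ≤ k ≤ m`.
Summed over `k`, the products of these sizes give `f₁ s s' - g₁ n + l₁`, which depends on the cut
only through `s s'`. Summing over the `n - 1` edges, and using `h₁ = g₁ + l₁`, one gets the linear
recurrence `W' = f₁ W - g₁ n ^ 2 + h₁ n - l₁`.
-/

noncomputable section

namespace SubdivisionTree

universe u

/-! ### Hitting times from a Poisson equation -/

/-- The event that a trajectory stays away from `y` up to and including time `k`. -/
def avoids {V : Type u} (y : V) (k : ℕ) : Set (ℕ → V) :=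
  {ω | ∀ i ≤ k, ω i ≠ y}

theorem firstHit_eq_tsum_indicator_avoids {V : Type u} (y : V) (ω : ℕ → V) :
    firstHit y ω = ∑' k, (avoids y k).indicator 1 ω := by
  classical
  by_cases hit : ∃ k, ω k = y
  · have firstHit_eq : firstHit y ω = Nat.find hit :=
      le_antisymm (iInf₂_le (Nat.find hit) (Nat.find_spec hit))
        (le_iInf₂ fun k hk => Nat.cast_le.2 (Nat.find_min' hit hk))
    have indicator_eq (k : ℕ) : (avoids y k).indicator (1 : (ℕ → V) → ℝ≥0∞) ω =
        (Finset.range (Nat.find hit) : Set ℕ).indicator 1 k := by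
      simp [Set.indicator_apply, avoids, Nat.lt_find_iff]
    simp_rw [firstHit_eq, indicator_eq, ← sum_eq_tsum_indicator]
    simp
  · push Not at hit
    simp [firstHit, avoids, hit]

theorem measurableSet_avoids {V : Type u} [MeasurableSpace V] [MeasurableSingletonClass V] (y : V)
    (k : ℕ) : MeasurableSet (avoids y k) := by
  have avoids_eq : avoids y k = ⋂ i ∈ Finset.Iic k, (fun ω => ω i) ⁻¹' {y}ᶜ := by
    ext ω
    simp [avoids]
  rw [avoids_eq]
  exact Finset.measurableSet_biInter _ fun i _ =>
    measurable_pi_apply i (measurableSet_singleton y).compl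

theorem lintegral_firstHit {V : Type u} [MeasurableSpace V] [MeasurableSingletonClass V]
    (μ : Measure (ℕ → V)) (y : V) : ∫⁻ ω, firstHit y ω ∂μ = ∑' k, μ (avoids y k) := by
  simp_rw [firstHit_eq_tsum_indicator_avoids]
  rw [lintegral_tsum fun k =>
    (measurable_one.indicator (measurableSet_avoids y k)).aemeasurable]
  exact tsum_congr fun k => lintegral_indicator_one (measurableSet_avoids y k)

section RandomWalk

variable {V : Type u} [Fintype V]

section Walk

variable [MeasurableSpace V] [DiscreteMeasurableSpace V] (G : SimpleGraph V)

instance (x : V) : IsProbabilityMeasure (walkLaw G x) := by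
  unfold walkLaw; infer_instance

theorem walkLaw_map_frestrictLe (x : V) (k : ℕ) :
    (walkLaw G x).map (Preorder.frestrictLe k) =
      Kernel.partialTraj (X := fun _ : ℕ => V) (stepKernel G) 0 k (fun _ => x) := by
  rw [← Kernel.traj_map_frestrictLe, Kernel.map_apply _ (by fun_prop), walkLaw]

theorem walkLaw_zero (x : V) : ∀ᵐ ω ∂(walkLaw G x), ω 0 = x := by
  have start : ∀ᵐ p ∂((walkLaw G x).map (Preorder.frestrictLe 0)),
      p ⟨0, Finset.mem_Iic.2 le_rfl⟩ = x := by
    rw [walkLaw_map_frestrictLe, Kernel.partialTraj_self, Kernel.id_apply,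
      ae_dirac_iff MeasurableSet.of_discrete]
  exact ae_of_ae_map (by fun_prop) start

theorem setLIntegral_walkLaw_succ (x : V) (k : ℕ)
    (B : Set ((i : Finset.Iic k) → (fun _ : ℕ => V) i)) (f : V → ℝ≥0∞) :
    ∫⁻ ω in Preorder.frestrictLe k ⁻¹' B, f (ω (k + 1)) ∂(walkLaw G x) =
      ∫⁻ ω in Preorder.frestrictLe k ⁻¹' B, ∑ z, f z * stepLaw G (ω k) z ∂(walkLaw G x) := by
  have hf : Measurable f := .of_discrete
  have hB : MeasurableSet B := .of_discrete
  have history_and_step := Kernel.partialTraj_compProd_eq_map_traj (X := fun _ : ℕ => V)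
    (κ := stepKernel G) (zero_le (a := k)) (x₀ := fun _ => x)
  rw [← walkLaw_map_frestrictLe, ← walkLaw] at history_and_step
  calc ∫⁻ ω in Preorder.frestrictLe k ⁻¹' B, f (ω (k + 1)) ∂(walkLaw G x)
      = ∫⁻ p in B ×ˢ Set.univ, f p.2
          ∂((walkLaw G x).map fun ω => (Preorder.frestrictLe k ω, ω (k + 1))) := by
        rw [setLIntegral_map (hB.prod .univ) (by fun_prop) (by fun_prop)]
        congr 2
        ext ω
        simp
    _ = ∫⁻ p in B, ∫⁻ z, f z ∂(stepKernel G k p)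
          ∂((walkLaw G x).map (Preorder.frestrictLe k)) := by
        rw [← history_and_step, Measure.setLIntegral_compProd (by fun_prop) hB .univ]
        simp
    _ = _ := by
        rw [setLIntegral_map hB (hf.lintegral_kernel) (by fun_prop)]
        refine lintegral_congr fun ω => ?_
        change ∫⁻ z, f z ∂(stepLaw G (ω k)).toMeasure = _
        simp_rw [lintegral_fintype, PMF.toMeasure_apply_singleton _ _ (MeasurableSet.of_discrete)]

theorem setLIntegral_avoids_succ (x y : V) (k : ℕ) {h : V → ℝ≥0∞} (hy : h y = 0) :
    ∫⁻ ω in avoids y (k + 1), h (ω (k + 1)) ∂(walkLaw G x) =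
      ∫⁻ ω in avoids y k, ∑ z, h z * stepLaw G (ω k) z ∂(walkLaw G x) := by
  have avoids_eq : avoids y k = Preorder.frestrictLe k ⁻¹' {p | ∀ i, p i ≠ y} := by
    ext ω
    simp [avoids]
  rw [avoids_eq, ← setLIntegral_walkLaw_succ, ← avoids_eq,
    ← lintegral_indicator (measurableSet_avoids y _),
    ← lintegral_indicator (measurableSet_avoids y _)]
  refine lintegral_congr fun ω => ?_
  have mem_avoids_succ : ω ∈ avoids y (k + 1) ↔ ω ∈ avoids y k ∧ ω (k + 1) ≠ y := by
    simp [avoids, Nat.le_succ_iff, or_imp, forall_and]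
  by_cases hω : ω (k + 1) = y <;> by_cases hω' : ω ∈ avoids y k <;>
    simp [mem_avoids_succ, hω, hω', hy]

variable {G} {y : V} {h : V → ℝ≥0∞}

theorem setLIntegral_avoids_zero (hy : h y = 0) (x : V) :
    ∫⁻ ω in avoids y 0, h (ω 0) ∂(walkLaw G x) = h x := by
  have integrand_eq : ∀ᵐ ω ∂(walkLaw G x), (avoids y 0).indicator (fun ω => h (ω 0)) ω = h x := by
    filter_upwards [walkLaw_zero G x] with ω hω
    by_cases hxy : x = y <;> simp [avoids, hω, hxy, hy]
  rw [← lintegral_indicator (measurableSet_avoids y 0), lintegral_congr_ae integrand_eq]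
  simp

theorem setLIntegral_avoids_eq_add (hy : h y = 0)
    (poisson : ∀ x, x ≠ y → h x = 1 + ∑ z, h z * stepLaw G x z) (x : V) (k : ℕ) :
    ∫⁻ ω in avoids y k, h (ω k) ∂(walkLaw G x) =
      walkLaw G x (avoids y k) + ∫⁻ ω in avoids y (k + 1), h (ω (k + 1)) ∂(walkLaw G x) := by
  rw [setLIntegral_avoids_succ G x y k hy, ← setLIntegral_one,
    ← lintegral_add_left measurable_const]
  exact setLIntegral_congr_fun (measurableSet_avoids y k) fun ω hω => poisson _ (hω k le_rfl)

theorem sum_walkLaw_avoids_add (hy : h y = 0)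
    (poisson : ∀ x, x ≠ y → h x = 1 + ∑ z, h z * stepLaw G x z) (x : V) (k : ℕ) :
    ∑ j ∈ Finset.range k, walkLaw G x (avoids y j) +
      ∫⁻ ω in avoids y k, h (ω k) ∂(walkLaw G x) = h x := by
  induction k with
  | zero => simpa using setLIntegral_avoids_zero hy x
  | succ k ih =>
    rw [Finset.sum_range_succ, add_assoc, ← setLIntegral_avoids_eq_add hy poisson, ih]

theorem tendsto_setLIntegral_avoids {x : V} (hfin : ∀ z, h z ≠ ⊤)
    (hsum : ∑' k, walkLaw G x (avoids y k) ≠ ⊤) :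
    Filter.Tendsto (fun k => ∫⁻ ω in avoids y k, h (ω k) ∂(walkLaw G x)) Filter.atTop (nhds 0) := by
  have le_const_mul (k : ℕ) : ∫⁻ ω in avoids y k, h (ω k) ∂(walkLaw G x) ≤
      (∑ z, h z) * walkLaw G x (avoids y k) := by
    rw [← setLIntegral_const]
    exact lintegral_mono fun ω => Finset.single_le_sum_of_canonicallyOrdered (Finset.mem_univ _)
  have tendsto_bound := ENNReal.Tendsto.const_mul (a := ∑ z, h z)
    (ENNReal.tendsto_atTop_zero_of_tsum_ne_top hsum) (Or.inr (by simp [hfin]))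
  rw [mul_zero] at tendsto_bound
  exact tendsto_of_tendsto_of_tendsto_of_le_of_le tendsto_const_nhds tendsto_bound
    (fun _ => zero_le) le_const_mul

theorem lintegral_firstHit_walkLaw (hfin : ∀ x, h x ≠ ⊤) (hy : h y = 0)
    (poisson : ∀ x, x ≠ y → h x = 1 + ∑ z, h z * stepLaw G x z) (x : V) :
    ∫⁻ ω, firstHit y ω ∂(walkLaw G x) = h x := by
  have telescope := sum_walkLaw_avoids_add hy poisson x
  have tsum_le : ∑' k, walkLaw G x (avoids y k) ≤ h x := by
    rw [ENNReal.tsum_eq_iSup_nat]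
    exact iSup_le fun k => telescope k ▸ le_self_add
  have tendsto_sum := (ENNReal.tendsto_nat_tsum fun k => walkLaw G x (avoids y k)).add
    (tendsto_setLIntegral_avoids hfin (ne_top_of_le_ne_top (hfin x) tsum_le))
  simp_rw [telescope, add_zero] at tendsto_sum
  rw [lintegral_firstHit]
  exact (tendsto_nhds_unique tendsto_const_nhds tendsto_sum).symm

end Walk

theorem hittingTime_eq {G : SimpleGraph V} {y : V} {h : V → ℝ≥0∞} (hfin : ∀ x, h x ≠ ⊤)
    (hy : h y = 0) (poisson : ∀ x, x ≠ y → h x = 1 + ∑ z, h z * stepLaw G x z) (x : V) :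
    hittingTime G x y = h x := by
  let _ : MeasurableSpace V := ⊤
  have : DiscreteMeasurableSpace V := ⟨fun _ => trivial⟩
  exact lintegral_firstHit_walkLaw hfin hy poisson x

open Classical in
theorem sum_ofReal_mul_stepLaw {G : SimpleGraph V} {h : V → ℝ} (hnn : ∀ x, 0 ≤ h x) {x : V}
    (hx : (G.neighborFinset x).Nonempty) :
    ∑ z, ENNReal.ofReal (h z) * stepLaw G x z =
      ENNReal.ofReal ((∑ z ∈ G.neighborFinset x, h z) / G.degree x) := by
  have degree_pos : 0 < (G.degree x : ℝ) := by
    rw [← G.card_neighborFinset_eq_degree]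
    exact_mod_cast hx.card_pos
  simp only [stepLaw, dif_pos hx, PMF.uniformOfFinset_apply, mul_ite, mul_zero,
    Finset.sum_ite_mem, Finset.univ_inter, ← Finset.sum_mul]
  rw [ENNReal.ofReal_div_of_pos degree_pos, ENNReal.ofReal_sum_of_nonneg fun z _ => hnn z,
    ENNReal.ofReal_natCast, G.card_neighborFinset_eq_degree, div_eq_mul_inv]

open Classical in
theorem hittingTime_eq_ofReal {G : SimpleGraph V} {y : V} {h : V → ℝ} (hnn : ∀ x, 0 ≤ h x)
    (hy : h y = 0) (hne : ∀ x, x ≠ y → ∃ z, G.Adj x z)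
    (poisson : ∀ x, x ≠ y → ∑ z ∈ G.neighborFinset x, (h z - h x) = -(G.degree x : ℝ)) (x : V) :
    hittingTime G x y = ENNReal.ofReal (h x) := by
  refine hittingTime_eq (h := fun x => ENNReal.ofReal (h x)) (fun _ => ENNReal.ofReal_ne_top)
    (by simp [hy]) (fun x hx => ?_) x
  have hN : (G.neighborFinset x).Nonempty := by simpa [Finset.Nonempty] using hne x hx
  have degree_ne_zero : (G.degree x : ℝ) ≠ 0 := by
    rw [← G.card_neighborFinset_eq_degree]
    exact_mod_cast hN.card_pos.ne'
  have mean_eq : h x = 1 + (∑ z ∈ G.neighborFinset x, h z) / G.degree x := by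
    have laplacian := poisson x hx
    rw [Finset.sum_sub_distrib, Finset.sum_const, G.card_neighborFinset_eq_degree,
      nsmul_eq_mul] at laplacian
    field_simp
    linarith
  rw [sum_ofReal_mul_stepLaw hnn hN, ← ENNReal.ofReal_one, ← ENNReal.ofReal_add zero_le_one
    (div_nonneg (Finset.sum_nonneg fun z _ => hnn z) (Nat.cast_nonneg _)), ← mean_eq]

end RandomWalk

/-! ### Hitting times in trees -/

/-- The Gromov product `(x | z)_y` of the graph metric. In a tree it is the length of the common
initial segment of the paths from `y` to `x` and from `y` to `z`. -/
def gromovProduct {V : Type u} (G : SimpleGraph V) (y x z : V) : ℝ :=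
  ((G.dist x y : ℝ) + G.dist y z - G.dist x z) / 2

section Tree

variable {V : Type u} {G : SimpleGraph V}

theorem gromovProduct_nonneg (hG : G.Connected) (y x z : V) : 0 ≤ gromovProduct G y x z := by
  have triangle : (G.dist x z : ℝ) ≤ G.dist x y + G.dist y z := by
    exact_mod_cast hG.dist_triangle
  unfold gromovProduct
  linarith

theorem gromovProduct_self (y z : V) : gromovProduct G y y z = 0 := by
  simp [gromovProduct]

theorem gromovProduct_add_gromovProduct (x y z : V) :
    gromovProduct G y x z + gromovProduct G x y z = G.dist x y := by
  unfold gromovProduct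
  rw [G.dist_comm (u := y) (v := x)]
  ring

theorem exists_adj_dist_add_one (hG : G.Connected) {x z : V} (hxz : x ≠ z) :
    ∃ p, G.Adj x p ∧ G.dist p z + 1 = G.dist x z := by
  obtain ⟨w, hw⟩ := hG.exists_walk_length_eq_dist x z
  cases w with
  | nil => exact absurd rfl hxz
  | @cons _ p _ h w =>
    refine ⟨p, h, ?_⟩
    have dist_le_length := G.dist_le w
    have triangle := hG.dist_triangle (u := x) (v := p) (w := z)
    rw [SimpleGraph.dist_eq_one_iff_adj.2 h] at triangle
    rw [SimpleGraph.Walk.length_cons] at hw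
    omega

theorem existsUnique_adj_dist_add_one (hG : G.IsTree) {x z : V} (hxz : x ≠ z) :
    ∃! p, G.Adj x p ∧ G.dist p z + 1 = G.dist x z := by
  refine existsUnique_of_exists_of_unique (exists_adj_dist_add_one hG.connected hxz) ?_
  have exists_path {p : V} (hp : G.Adj x p ∧ G.dist p z + 1 = G.dist x z) :
      ∃ P : G.Path x z, P.1.snd = p := by
    obtain ⟨w, hw⟩ := hG.connected.exists_walk_length_eq_dist p z
    exact ⟨⟨.cons hp.1 w, SimpleGraph.Walk.isPath_of_length_eq_dist _ (by
      rw [SimpleGraph.Walk.length_cons, hw, hp.2])⟩, by simp⟩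
  intro p q hp hq
  obtain ⟨P, rfl⟩ := exists_path hp
  obtain ⟨Q, rfl⟩ := exists_path hq
  rw [(hG.isAcyclic.subsingleton_path x z).elim P Q]

theorem dist_sub_dist_of_adj (hG : G.IsTree) {x x' : V} (z : V) (h : G.Adj x x') :
    (G.dist x' z : ℝ) - G.dist x z = if G.dist x' z + 1 = G.dist x z then -1 else 1 := by
  have dist_eq := hG.dist_eq_dist_add_one_of_adj z h
  rw [G.dist_comm (u := z), G.dist_comm (u := z)] at dist_eq
  rcases dist_eq with dist_eq | dist_eq <;> simp [dist_eq, add_assoc]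

end Tree

section FiniteTree

variable {V : Type u} [Fintype V] {G : SimpleGraph V}

open Classical in
theorem sum_dist_sub_dist (hG : G.IsTree) (x z : V) :
    ∑ x' ∈ G.neighborFinset x, ((G.dist x' z : ℝ) - G.dist x z) =
      G.degree x - if x = z then 0 else 2 := by
  rw [Finset.sum_congr rfl fun x' hx' =>
    dist_sub_dist_of_adj hG z ((G.mem_neighborFinset x x').1 hx')]
  split_ifs with hxz
  · simp [hxz]
  · obtain ⟨p, ⟨hp, hpz⟩, unique⟩ := existsUnique_adj_dist_add_one hG hxz
    calc ∑ x' ∈ G.neighborFinset x, (if G.dist x' z + 1 = G.dist x z then (-1 : ℝ) else 1)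
        = ∑ x' ∈ G.neighborFinset x, (1 - if x' = p then 2 else 0 : ℝ) := by
          refine Finset.sum_congr rfl fun x' hx' => ?_
          have closer_iff : G.dist x' z + 1 = G.dist x z ↔ x' = p :=
            ⟨fun h => unique x' ⟨(G.mem_neighborFinset x x').1 hx', h⟩, fun h => h ▸ hpz⟩
          simp only [closer_iff]
          split_ifs <;> norm_num
      _ = G.degree x - 2 := by simp [hp]

open Classical in
theorem sum_gromovProduct_sub (hG : G.IsTree) {x y : V} (hxy : x ≠ y) (z : V) :
    ∑ x' ∈ G.neighborFinset x, (gromovProduct G y x' z - gromovProduct G y x z) =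
      if x = z then -1 else 0 := by
  have sub_eq (x' : V) : gromovProduct G y x' z - gromovProduct G y x z =
      (((G.dist x' y : ℝ) - G.dist x y) - ((G.dist x' z : ℝ) - G.dist x z)) / 2 := by
    unfold gromovProduct
    ring
  simp_rw [sub_eq]
  rw [← Finset.sum_div, Finset.sum_sub_distrib, sum_dist_sub_dist hG, sum_dist_sub_dist hG,
    if_neg hxy]
  split_ifs <;> ring

open Classical in
theorem hittingTime_of_isTree (hG : G.IsTree) (x y : V) :
    hittingTime G x y = ENNReal.ofReal (∑ z, G.degree z * gromovProduct G y x z) := by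
  refine hittingTime_eq_ofReal (h := fun x => ∑ z, G.degree z * gromovProduct G y x z)
    (fun x => Finset.sum_nonneg fun z _ =>
      mul_nonneg (Nat.cast_nonneg _) (gromovProduct_nonneg hG.connected y x z))
    (by simp [gromovProduct_self])
    (fun x hx => (exists_adj_dist_add_one hG.connected hx).imp fun _ => And.left)
    (fun x hx => ?_) x
  simp_rw [← Finset.sum_sub_distrib, ← mul_sub]
  rw [Finset.sum_comm]
  simp [← Finset.mul_sum, sum_gromovProduct_sub hG hx]

theorem hittingTime_ne_top (hG : G.IsTree) (x y : V) : hittingTime G x y ≠ ⊤ := by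
  rw [hittingTime_of_isTree hG]
  exact ENNReal.ofReal_ne_top

open Classical in
theorem card_edgeFinset_of_isTree (hG : G.IsTree) :
    (G.edgeFinset.card : ℝ) = Fintype.card V - 1 := by
  rw [← hG.card_edgeFinset]
  push_cast
  ring

theorem hittingTime_add_hittingTime (hG : G.IsTree) (x y : V) :
    (hittingTime G x y).toReal + (hittingTime G y x).toReal =
      2 * ((Fintype.card V : ℝ) - 1) * G.dist x y := by
  classical
  have sum_degree : ∑ z, (G.degree z : ℝ) = 2 * ((Fintype.card V : ℝ) - 1) := by
    rw [← card_edgeFinset_of_isTree hG]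
    exact_mod_cast G.sum_degrees_eq_twice_card_edges
  have toReal_hittingTime (x y : V) :
      (hittingTime G x y).toReal = ∑ z, G.degree z * gromovProduct G y x z := by
    rw [hittingTime_of_isTree hG, ENNReal.toReal_ofReal (Finset.sum_nonneg fun z _ =>
      mul_nonneg (Nat.cast_nonneg _) (gromovProduct_nonneg hG.connected y x z))]
  simp_rw [toReal_hittingTime, ← Finset.sum_add_distrib, ← mul_add,
    gromovProduct_add_gromovProduct, ← Finset.sum_mul, sum_degree]

theorem toReal_sum_hittingTime (hG : G.IsTree) :
    (∑ x, ∑ y, hittingTime G x y).toReal =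
      ((Fintype.card V : ℝ) - 1) * (2 * wienerIndex G) := by
  have swap : ∑ x, ∑ y, (hittingTime G x y).toReal = ∑ x, ∑ y, (hittingTime G y x).toReal :=
    Finset.sum_comm
  have commute : ∑ x, ∑ y, (hittingTime G x y).toReal + ∑ x, ∑ y, (hittingTime G y x).toReal =
      2 * ((Fintype.card V : ℝ) - 1) * ∑ x, ∑ y, (G.dist x y : ℝ) := by
    simp_rw [← Finset.sum_add_distrib, hittingTime_add_hittingTime hG, Finset.mul_sum]
  rw [ENNReal.toReal_sum fun x _ => by simp [hittingTime_ne_top hG]]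
  simp_rw [ENNReal.toReal_sum fun y _ => hittingTime_ne_top hG _ y]
  unfold wienerIndex
  linarith

theorem meanHittingTime_of_isTree (hG : G.IsTree) (hV : 2 ≤ Fintype.card V) :
    meanHittingTime G ≠ ⊤ ∧
      (meanHittingTime G).toReal = 2 / (Fintype.card V : ℝ) * wienerIndex G := by
  have card_sub_one : (Fintype.card V : ℝ≥0∞) - 1 = ((Fintype.card V - 1 : ℕ) : ℝ≥0∞) := by simp
  unfold meanHittingTime
  rw [card_sub_one]
  constructor
  · refine ENNReal.div_ne_top (by simp [hittingTime_ne_top hG]) ?_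
    exact_mod_cast mul_ne_zero (by omega : Fintype.card V ≠ 0) (by omega)
  · have hV' : (2 : ℝ) ≤ Fintype.card V := by exact_mod_cast hV
    have card_ne_zero : (Fintype.card V : ℝ) ≠ 0 := by linarith
    have card_sub_one_ne_zero : (Fintype.card V : ℝ) - 1 ≠ 0 := by linarith
    rw [ENNReal.toReal_div, ENNReal.toReal_mul, toReal_sum_hittingTime hG, ENNReal.toReal_natCast,
      ENNReal.toReal_natCast, Nat.cast_sub (by omega), Nat.cast_one]
    field_simp

end FiniteTree

/-! ### Wiener index by cuts -/

section Cut

variable {V : Type u} {G : SimpleGraph V}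

/-- `S` is a side of a cut of `G` that consists of the single edge `ab`, with `a` in `S` and `b` on
the other side. Neither side is required to be connected. -/
structure IsCutSide (G : SimpleGraph V) (S : Set V) (a b : V) : Prop where
  adj : G.Adj a b
  left_mem : a ∈ S
  right_notMem : b ∉ S
  eq_of_adj : ∀ ⦃u v⦄, G.Adj u v → u ∈ S → v ∉ S → u = a ∧ v = b

namespace IsCutSide

variable {S : Set V} {a b : V}

theorem mk_eq_mk_iff (h : IsCutSide G S a b) {u v : V} (huv : G.Adj u v) :
    s(a, b) = s(u, v) ↔ ¬(u ∈ S ↔ v ∈ S) := by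
  have := h.left_mem
  have := h.right_notMem
  have := h.eq_of_adj huv
  have := h.eq_of_adj huv.symm
  grind [Sym2.eq_iff]

theorem mem_edges_iff (h : IsCutSide G S a b) {u v : V} {w : G.Walk u v} (hw : w.IsTrail) :
    s(a, b) ∈ w.edges ↔ ¬(u ∈ S ↔ v ∈ S) := by
  induction w with
  | nil => simp
  | @cons u x v hux w ih =>
    obtain ⟨hw, notMem_edges⟩ := (SimpleGraph.Walk.isTrail_cons hux w).1 hw
    have first_edge := h.mk_eq_mk_iff hux
    rw [SimpleGraph.Walk.edges_cons, List.mem_cons]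
    grind

theorem isBridge (h : IsCutSide G S a b) : G.IsBridge s(a, b) := by
  classical
  rw [SimpleGraph.isBridge_iff_forall_walk_mem_edges]
  intro w
  refine w.edges_toPath_subset_edges ((h.mem_edges_iff w.toPath.2.isTrail).2 ?_)
  simp [h.left_mem, h.right_notMem]

theorem connected_induce (h : IsCutSide G S a b) (hG : G.Connected) : (G.induce S).Connected := by
  have reachable_left {u v : V} : G.Walk u v → ∀ hu : u ∈ S, v ∉ S →
      (G.induce S).Reachable ⟨u, hu⟩ ⟨a, h.left_mem⟩ := by
    intro w hu hv
    induction w with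
    | nil => exact absurd hu hv
    | @cons u x v hux _ ih =>
      by_cases hx : x ∈ S
      · have adj_induce : (G.induce S).Adj ⟨u, hu⟩ ⟨x, hx⟩ := hux
        exact adj_induce.reachable.trans (ih hx hv)
      · obtain ⟨rfl, -⟩ := h.eq_of_adj hux hu hx
        exact .rfl
  exact SimpleGraph.connected_iff_exists_forall_reachable _ |>.2 ⟨⟨a, h.left_mem⟩, fun u =>
    (reachable_left (hG.preconnected u b).some u.2 h.right_notMem).symm⟩

end IsCutSide

theorem isCutSide_reachable_deleteEdges (hG : G.IsAcyclic) {a b : V} (hab : G.Adj a b) :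
    IsCutSide G {u | (G.deleteEdges {s(a, b)}).Reachable a u} a b := by
  have not_reachable : ¬ (G.deleteEdges {s(a, b)}).Reachable a b :=
    SimpleGraph.isBridge_iff.1 (SimpleGraph.isAcyclic_iff_forall_isBridge.1 hG hab)
  refine ⟨hab, .rfl, not_reachable, fun u v huv hu hv => ?_⟩
  have mk_eq : s(u, v) = s(a, b) := by
    by_contra hne
    exact hv (hu.trans (SimpleGraph.Adj.reachable (by simp [huv, hne])))
  rcases Sym2.eq_iff.1 mk_eq with huv_eq | ⟨rfl, rfl⟩
  · exact huv_eq
  · exact absurd hu not_reachable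

theorem ncard_edgeSet_inter_sym2_add_one [Finite V] (hG : G.IsAcyclic) {S : Set V}
    (hS : (G.induce S).Connected) : (G.edgeSet ∩ S.sym2).ncard + 1 = S.ncard := by
  classical
  have := Fintype.ofFinite V
  have card_induce := (⟨hS, hG.induce S⟩ : (G.induce S).IsTree).card_edgeFinset
  rw [← Finset.card_map (Function.Embedding.subtype (· ∈ S)).sym2Map,
    SimpleGraph.map_edgeFinset_induce] at card_induce
  rw [Set.ncard_eq_toFinset_card' S, Set.toFinset_card, ← card_induce,
    ← Set.ncard_coe_finset]
  congr
  ext e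
  simp

variable {ι : Type*} [Fintype ι] {S : ι → Set V} {a b : ι → V}

open Classical in
theorem dist_eq_card_separating (hG : G.Connected) (h : ∀ i, IsCutSide G (S i) (a i) (b i))
    (hι : ∀ e ∈ G.edgeSet, ∃! i, s(a i, b i) = e) (u v : V) :
    G.dist u v = Finset.card {i | ¬(u ∈ S i ↔ v ∈ S i)} := by
  obtain ⟨w, hw, hlen⟩ := hG.exists_path_of_dist u v
  rw [← hlen, ← w.length_edges, ← List.toFinset_card_of_nodup hw.isTrail.edges_nodup]
  refine (Finset.card_nbij (fun i => s(a i, b i)) ?_ ?_ ?_).symm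
  · intro i hi
    simpa [(h i).mem_edges_iff hw.isTrail] using hi
  · intro i _ j _ hij
    exact (hι _ (h j).adj).unique hij rfl
  · intro e he
    obtain ⟨i, rfl, -⟩ := hι e (w.edges_subset_edgeSet (by simpa using he))
    exact ⟨i, by simpa [(h i).mem_edges_iff hw.isTrail] using he, rfl⟩

open Classical in
theorem sum_sum_separating [Fintype V] (S : Set V) :
    ∑ u, ∑ v, (if ¬(u ∈ S ↔ v ∈ S) then (1 : ℝ) else 0) = 2 * (S.ncard * Sᶜ.ncard) := by
  have ite_eq (u v : V) : (if ¬(u ∈ S ↔ v ∈ S) then (1 : ℝ) else 0) =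
      S.indicator 1 u * Sᶜ.indicator 1 v + Sᶜ.indicator 1 u * S.indicator 1 v := by
    by_cases hu : u ∈ S <;> by_cases hv : v ∈ S <;> simp [hu, hv]
  have sum_indicator (A : Set V) : ∑ u, A.indicator (1 : V → ℝ) u = A.ncard := by
    simp [Set.indicator_apply, Set.ncard_eq_toFinset_card' A, Set.toFinset_card,
      Fintype.card_subtype]
  simp_rw [ite_eq, Finset.sum_add_distrib, ← Finset.mul_sum, ← Finset.sum_mul, sum_indicator]
  ring

theorem wienerIndex_eq_sum_cuts [Fintype V] (hG : G.Connected)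
    (h : ∀ i, IsCutSide G (S i) (a i) (b i)) (hι : ∀ e ∈ G.edgeSet, ∃! i, s(a i, b i) = e) :
    wienerIndex G = ∑ i, ((S i).ncard : ℝ) * (S i)ᶜ.ncard := by
  classical
  have sum_dist : ∑ u, ∑ v, (G.dist u v : ℝ) = ∑ i, 2 * (((S i).ncard : ℝ) * (S i)ᶜ.ncard) := by
    simp_rw [dist_eq_card_separating hG h hι, Finset.natCast_card_filter, ← sum_sum_separating]
    rw [Finset.sum_comm_cycle]
  rw [wienerIndex, sum_dist, ← Finset.mul_sum]
  ring

end Cut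

/-! ### Subdividing the edges of a tree -/

section Subdivision

variable {V : Type u} {G : SimpleGraph V} {m : ℕ}

/-- The end of `e` at which `edgePath` starts. -/
abbrev src (e : G.edgeSet) : V := (Quot.out (e : Sym2 V)).1

/-- The end of `e` at which `edgePath` stops. -/
abbrev tgt (e : G.edgeSet) : V := (Quot.out (e : Sym2 V)).2

theorem mk_src_tgt (e : G.edgeSet) : s(src e, tgt e) = (e : Sym2 V) :=
  Quot.out_eq (e : Sym2 V)

theorem adj_src_tgt (e : G.edgeSet) : G.Adj (src e) (tgt e) := by
  rw [← SimpleGraph.mem_edgeSet, mk_src_tgt]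
  exact e.2

theorem edge_mem_sym2_iff (S : Set V) (e : G.edgeSet) :
    (e : Sym2 V) ∈ S.sym2 ↔ src e ∈ S ∧ tgt e ∈ S := by
  rw [← mk_src_tgt, Set.mk_mem_sym2_iff]

theorem edgePath_zero (e : G.edgeSet) : edgePath m G e 0 = Sum.inl (src e) := if_pos rfl

theorem edgePath_last (e : G.edgeSet) : edgePath m G e (m + 1) = Sum.inl (tgt e) := by
  simp [edgePath]

theorem edgePath_inner (e : G.edgeSet) (i : Fin m) :
    edgePath m G e ((i : ℕ) + 1) = Sum.inr (e, i) := by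
  simp [edgePath]

theorem edgePath_adj (e : G.edgeSet) {k : ℕ} (hk : k ≤ m) :
    (subdivision m G).Adj (edgePath m G e k) (edgePath m G e (k + 1)) := by
  refine (SimpleGraph.fromEdgeSet_adj _).2 ⟨⟨e, k, hk, rfl⟩, ?_⟩
  have := (adj_src_tgt e).ne
  unfold edgePath
  split_ifs <;> simp_all <;> omega

theorem exists_edgePath_of_mem_edgeSet {s : Sym2 (SubdivVertex m G)}
    (hs : s ∈ (subdivision m G).edgeSet) :
    ∃ e : G.edgeSet, ∃ k ≤ m, s = s(edgePath m G e k, edgePath m G e (k + 1)) := by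
  rw [subdivision, SimpleGraph.edgeSet_fromEdgeSet] at hs
  exact hs.1

theorem reachable_edgePath (e : G.edgeSet) {k : ℕ} (hk : k ≤ m + 1) :
    (subdivision m G).Reachable (Sum.inl (src e)) (edgePath m G e k) := by
  induction k with
  | zero => rw [edgePath_zero]
  | succ k ih => exact (ih (by omega)).trans (edgePath_adj e (by omega)).reachable

theorem reachable_inl_of_adj {u v : V} (huv : G.Adj u v) :
    (subdivision m G).Reachable (Sum.inl u) (Sum.inl v) := by
  have ends_reachable := reachable_edgePath (m := m) (⟨s(u, v), huv⟩ : G.edgeSet) le_rfl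
  rw [edgePath_last] at ends_reachable
  rcases Sym2.eq_iff.1 (mk_src_tgt (⟨s(u, v), huv⟩ : G.edgeSet)) with ⟨hu, hv⟩ | ⟨hv, hu⟩
  · rwa [hu, hv] at ends_reachable
  · rw [hu, hv] at ends_reachable
    exact ends_reachable.symm

theorem connected_subdivision (hG : G.Connected) : (subdivision m G).Connected := by
  have reachable_inl {u v : V} (w : G.Walk u v) :
      (subdivision m G).Reachable (Sum.inl u) (Sum.inl v) := by
    induction w with
    | nil => rfl
    | cons h _ ih => exact (reachable_inl_of_adj h).trans ih
  obtain ⟨u⟩ := hG.nonempty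
  refine (SimpleGraph.connected_iff_exists_forall_reachable _).2 ⟨Sum.inl u, ?_⟩
  rintro (v | ⟨e, i⟩)
  · exact reachable_inl (hG.preconnected u v).some
  · rw [← edgePath_inner]
    exact (reachable_inl (hG.preconnected u (src e)).some).trans (reachable_edgePath e (by omega))

/-- If `S` is the side of `src e` in the cut of `G` at the edge `e`, this is the side of `src e` in
the cut of `subdivision m G` at the edge between `edgePath m G e k` and `edgePath m G e (k + 1)`. -/
def subdivisionSide (m : ℕ) (S : Set V) (e : G.edgeSet) (k : ℕ) : Set (SubdivVertex m G) :=
  Sum.inl '' S ∪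
    Sum.inr '' ({f : G.edgeSet | (f : Sym2 V) ∈ S.sym2} ×ˢ Set.univ ∪
      {e} ×ˢ {i : Fin m | (i : ℕ) < k})

variable {S : Set V} {e : G.edgeSet} {k : ℕ}

theorem edgePath_mem_subdivisionSide_iff (h : IsCutSide G S (src e) (tgt e)) (hk : k ≤ m)
    (f : G.edgeSet) {j : ℕ} (hj : j ≤ m + 1) :
    edgePath m G f j ∈ subdivisionSide m S e k ↔ f = e ∧ j ≤ k ∨ f ≠ e ∧ src f ∈ S := by
  have src_mem := h.left_mem
  have tgt_notMem := h.right_notMem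
  have ends_same_side : f ≠ e → (src f ∈ S ↔ tgt f ∈ S) := by
    have cut_iff := h.mk_eq_mk_iff (adj_src_tgt f)
    rw [mk_src_tgt, mk_src_tgt, ← Subtype.ext_iff] at cut_iff
    tauto
  obtain rfl | ⟨i, rfl⟩ | rfl : j = 0 ∨ (∃ i : Fin m, j = i + 1) ∨ j = m + 1 := by
    rcases j with _ | j
    · simp
    · by_cases hj' : j < m
      · exact .inr (.inl ⟨⟨j, hj'⟩, rfl⟩)
      · omega
  · rw [edgePath_zero]
    grind [subdivisionSide]
  · rw [edgePath_inner]
    simp only [subdivisionSide, Set.mem_union, Set.mem_image, edge_mem_sym2_iff]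
    grind
  · rw [edgePath_last]
    grind [subdivisionSide]

theorem isCutSide_subdivisionSide (h : IsCutSide G S (src e) (tgt e)) (hk : k ≤ m) :
    IsCutSide (subdivision m G) (subdivisionSide m S e k) (edgePath m G e k)
      (edgePath m G e (k + 1)) where
  adj := edgePath_adj e hk
  left_mem := by simp [edgePath_mem_subdivisionSide_iff h hk e (by omega : k ≤ m + 1)]
  right_notMem := by simp [edgePath_mem_subdivisionSide_iff h hk e (by omega : k + 1 ≤ m + 1)]
  eq_of_adj p q hpq hp hq := by
    obtain ⟨f, j, hj, hpq⟩ := exists_edgePath_of_mem_edgeSet (SimpleGraph.mem_edgeSet _ |>.2 hpq)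
    have mem_iff := edgePath_mem_subdivisionSide_iff h hk f (by omega : j ≤ m + 1)
    have mem_succ_iff := edgePath_mem_subdivisionSide_iff h hk f (by omega : j + 1 ≤ m + 1)
    rcases Sym2.eq_iff.1 hpq with ⟨rfl, rfl⟩ | ⟨rfl, rfl⟩
    · rw [mem_iff] at hp
      rw [mem_succ_iff] at hq
      obtain ⟨rfl, rfl⟩ : f = e ∧ j = k := by grind
      exact ⟨rfl, rfl⟩
    · grind

/-- The vertices that remain on the side of `src e` when the edge `e` is removed. -/
def edgeSide (e : G.edgeSet) : Set V :=
  {u | (G.deleteEdges {(e : Sym2 V)}).Reachable (src e) u}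

theorem isCutSide_edgeSide (hG : G.IsAcyclic) (e : G.edgeSet) :
    IsCutSide G (edgeSide e) (src e) (tgt e) := by
  simpa only [edgeSide, mk_src_tgt] using isCutSide_reachable_deleteEdges hG (adj_src_tgt e)

theorem isTree_subdivision (hG : G.IsTree) : (subdivision m G).IsTree := by
  refine ⟨connected_subdivision hG.connected, SimpleGraph.isAcyclic_iff_forall_isBridge.2 ?_⟩
  intro s hs
  obtain ⟨e, k, hk, rfl⟩ := exists_edgePath_of_mem_edgeSet hs
  exact (isCutSide_subdivisionSide (isCutSide_edgeSide hG.isAcyclic e) hk).isBridge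

theorem existsUnique_edgePath_of_mem_edgeSet (hG : G.IsAcyclic) {s : Sym2 (SubdivVertex m G)}
    (hs : s ∈ (subdivision m G).edgeSet) :
    ∃! i : G.edgeSet × Fin (m + 1), s(edgePath m G i.1 i.2, edgePath m G i.1 (i.2 + 1)) = s := by
  obtain ⟨e, k, hk, rfl⟩ := exists_edgePath_of_mem_edgeSet hs
  refine ⟨(e, ⟨k, by omega⟩), rfl, fun ⟨f, j⟩ hfj => ?_⟩
  have cut := isCutSide_edgeSide hG e
  have separated := ((isCutSide_subdivisionSide cut hk).mk_eq_mk_iff (edgePath_adj f j.is_le)).1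
    hfj.symm
  rw [edgePath_mem_subdivisionSide_iff cut hk f (by omega),
    edgePath_mem_subdivisionSide_iff cut hk f (by omega)] at separated
  obtain ⟨rfl, rfl⟩ : f = e ∧ (j : ℕ) = k := by grind
  rfl

/-! ### Wiener index of a subdivided tree -/

theorem ncard_subdivisionSide [Finite V] (hG : G.IsTree) (h : IsCutSide G S (src e) (tgt e))
    (hk : k ≤ m) :
    ((subdivisionSide m S e k).ncard : ℝ) = (m + 1) * S.ncard - m + k := by
  have ncard_edges : {f : G.edgeSet | (f : Sym2 V) ∈ S.sym2}.ncard + 1 = S.ncard := by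
    rw [← ncard_edgeSet_inter_sym2_add_one hG.isAcyclic (h.connected_induce hG.connected),
      ← Set.ncard_image_of_injective _ Subtype.val_injective]
    congr
    exact Subtype.image_preimage_coe _ _
  have ncard_initial : {i : Fin m | (i : ℕ) < k}.ncard = k := by
    simp [Set.ncard_eq_toFinset_card', Fin.card_filter_val_lt, hk]
  have edge_notMem : (e : Sym2 V) ∉ S.sym2 := fun he =>
    h.right_notMem ((edge_mem_sym2_iff S e).1 he).2
  rw [subdivisionSide, Set.ncard_union_eq, Set.ncard_image_of_injective _ Sum.inl_injective,
    Set.ncard_image_of_injective _ Sum.inr_injective, Set.ncard_union_eq, Set.ncard_prod,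
    Set.ncard_prod, Set.ncard_univ, Nat.card_fin, Set.ncard_singleton, ncard_initial, ← ncard_edges]
  · push_cast
    ring
  · rw [Set.disjoint_left]
    rintro ⟨f, i⟩ hf ⟨rfl, -⟩
    exact edge_notMem hf.1
  · exact Set.disjoint_image_inl_image_inr

theorem natCard_subdivVertex [Finite V] (hG : G.IsTree) :
    (Nat.card (SubdivVertex m G) : ℝ) = (m + 1) * Nat.card V - m := by
  rw [Nat.card_sum, Nat.card_prod, Nat.card_fin,
    ← (SimpleGraph.isTree_iff_connected_and_card.1 hG).2]
  push_cast
  ring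

theorem ncard_compl_subdivisionSide [Finite V] (hG : G.IsTree)
    (h : IsCutSide G S (src e) (tgt e)) (hk : k ≤ m) :
    ((subdivisionSide m S e k)ᶜ.ncard : ℝ) = (m + 1) * Sᶜ.ncard - k := by
  have card_vertices : (S.ncard : ℝ) + Sᶜ.ncard = Nat.card V := by
    exact_mod_cast S.ncard_add_ncard_compl
  have card_subdivVertices : ((subdivisionSide m S e k).ncard : ℝ) +
      (subdivisionSide m S e k)ᶜ.ncard = Nat.card (SubdivVertex m G) := by
    exact_mod_cast (subdivisionSide m S e k).ncard_add_ncard_compl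
  rw [ncard_subdivisionSide hG h hk, natCard_subdivVertex hG, ← card_vertices]
    at card_subdivVertices
  linarith

theorem sum_range_add_mul_sub {K : Type*} [Field K] [CharZero K] (x y : K) (N : ℕ) :
    ∑ k ∈ Finset.range N, (x + k) * (y - k) =
      N * x * y + (y - x) * (N * (N - 1) / 2) - N * (N - 1) * (2 * N - 1) / 6 := by
  induction N with
  | zero => simp
  | succ N ih =>
    rw [Finset.sum_range_succ, ih]
    push_cast
    ring

theorem sum_cuts_subdivisionSide [Finite V] (hG : G.IsTree) (h : IsCutSide G S (src e) (tgt e)) :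
    ∑ k : Fin (m + 1),
        ((subdivisionSide m S e k).ncard : ℝ) * (subdivisionSide m S e k)ᶜ.ncard =
      f₁ m * (S.ncard * Sᶜ.ncard) - g₁ m * Nat.card V + l₁ m := by
  have card_vertices : (S.ncard : ℝ) + Sᶜ.ncard = Nat.card V := by
    exact_mod_cast S.ncard_add_ncard_compl
  simp_rw [fun k : Fin (m + 1) => ncard_subdivisionSide hG h k.is_le,
    fun k : Fin (m + 1) => ncard_compl_subdivisionSide hG h k.is_le]
  rw [Fin.sum_univ_eq_sum_range fun k : ℕ =>
      ((m + 1 : ℝ) * S.ncard - m + k) * ((m + 1) * Sᶜ.ncard - k),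
    sum_range_add_mul_sub, ← card_vertices, f₁, g₁, l₁]
  push_cast
  ring

theorem wienerIndex_subdivision [Fintype V] [Fintype (SubdivVertex m G)] (hG : G.IsTree) :
    wienerIndex (subdivision m G) = f₁ m * wienerIndex G - g₁ m * (Fintype.card V : ℝ) ^ 2 +
      h₁ m * Fintype.card V - l₁ m := by
  classical
  have cut (e : G.edgeSet) := isCutSide_edgeSide hG.isAcyclic e
  have wiener := wienerIndex_eq_sum_cuts hG.connected cut fun s hs =>
    ⟨⟨s, hs⟩, mk_src_tgt _, fun e he => Subtype.ext ((mk_src_tgt e).symm.trans he)⟩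
  have wiener_subdivision := wienerIndex_eq_sum_cuts (connected_subdivision (m := m) hG.connected)
    (fun i : G.edgeSet × Fin (m + 1) => isCutSide_subdivisionSide (cut i.1) i.2.is_le)
    fun s hs => existsUnique_edgePath_of_mem_edgeSet hG.isAcyclic hs
  rw [wiener_subdivision, wiener, Fintype.sum_prod_type]
  simp_rw [sum_cuts_subdivisionSide hG (cut _)]
  rw [Finset.sum_add_distrib, Finset.sum_sub_distrib, ← Finset.mul_sum, Finset.sum_const,
    Finset.sum_const, Finset.card_univ, ← SimpleGraph.edgeFinset_card, nsmul_eq_mul, nsmul_eq_mul,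
    card_edgeFinset_of_isTree hG, Nat.card_eq_fintype_card, h₁, g₁, l₁]
  ring

end Subdivision

/-! ### Iterated subdivision -/

theorem eq_of_linear_recurrence {R : Type*} [CommSemiring R] {f : R} {a b : ℕ → R}
    (rec : ∀ t, a (t + 1) = f * a t + b t) (t : ℕ) :
    a t = f ^ t * a 0 + ∑ i ∈ Finset.range t, f ^ i * b (t - 1 - i) := by
  induction t with
  | zero => simp
  | succ t ih =>
    have index_eq (i : ℕ) : t + 1 - 1 - (i + 1) = t - 1 - i := by omega
    simp_rw [Finset.sum_range_succ', index_eq, rec, ih, mul_add, Finset.mul_sum, pow_succ',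
      mul_assoc]
    simp [add_assoc]

section Iterated

variable {V : Type u} {T : SimpleGraph V} (hT : T.IsTree) (m t : ℕ)
include hT

theorem isTree_graph : (graph m T t).IsTree := by
  induction t with
  | zero => exact hT
  | succ t ih => exact isTree_subdivision ih

variable [Fintype V]

theorem card_vert :
    (Fintype.card (Vert m T t) : ℝ) = ((Fintype.card V : ℝ) - 1) * ((m : ℝ) + 1) ^ t + 1 := by
  simp_rw [← Nat.card_eq_fintype_card]
  induction t with
  | zero => simp [Vert, iterSubdivision]
  | succ t ih =>
    have card_succ : (Nat.card (Vert m T (t + 1)) : ℝ) = (m + 1) * Nat.card (Vert m T t) - m :=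
      natCard_subdivVertex (isTree_graph hT m t)
    rw [card_succ, ih]
    ring

theorem two_le_card_vert (hV : 2 ≤ Fintype.card V) : 2 ≤ Fintype.card (Vert m T t) := by
  have growth : (1 : ℝ) ≤ ((m : ℝ) + 1) ^ t := one_le_pow₀ (by simp)
  have hV' : (2 : ℝ) ≤ Fintype.card V := by exact_mod_cast hV
  have two_le : (2 : ℝ) ≤ Fintype.card (Vert m T t) := by
    rw [card_vert hT]
    nlinarith
  exact_mod_cast two_le

theorem wienerIndex_graph :
    wienerIndex (graph m T t) = f₁ m ^ t * wienerIndex T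
      - g₁ m * ∑ i ∈ Finset.range t, f₁ m ^ i * (Fintype.card (Vert m T (t - 1 - i)) : ℝ) ^ 2
      + h₁ m * ∑ i ∈ Finset.range t, f₁ m ^ i * (Fintype.card (Vert m T (t - 1 - i)) : ℝ)
      - l₁ m * ∑ i ∈ Finset.range t, f₁ m ^ i := by
  have wiener_succ (t : ℕ) : wienerIndex (graph m T (t + 1)) = f₁ m * wienerIndex (graph m T t) +
      (-g₁ m * (Fintype.card (Vert m T t) : ℝ) ^ 2 + h₁ m * Fintype.card (Vert m T t) - l₁ m) := by
    let _ : Fintype (SubdivVertex m (graph m T t)) := inferInstanceAs (Fintype (Vert m T (t + 1)))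
    have wiener_subdivision := wienerIndex_subdivision (m := m) (isTree_graph hT m t)
    change wienerIndex (subdivision m (graph m T t)) = _
    linear_combination wiener_subdivision
  have wiener_zero : wienerIndex (graph m T 0) = wienerIndex T := by
    unfold wienerIndex
    congr!
  rw [eq_of_linear_recurrence (a := fun t => wienerIndex (graph m T t)) wiener_succ, wiener_zero]
  simp only [mul_add, mul_sub, Finset.sum_add_distrib, Finset.sum_sub_distrib, Finset.mul_sum]
  simp only [mul_left_comm _ (f₁ m ^ _), mul_comm (l₁ m), neg_mul, mul_neg, Finset.sum_neg_distrib]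
  ring

end Iterated

end SubdivisionTree

end

theorem propositionI7 {V : Type*} [Fintype V] (T : SimpleGraph V) (hT : T.IsTree)
    (n : ℕ) (hn : Fintype.card V = n) (m t : ℕ) :
    (Fintype.card (SubdivisionTree.Vert m T t) : ℝ) = ((n : ℝ) - 1) * ((m : ℝ) + 1) ^ t + 1 ∧
    (2 ≤ n →
      SubdivisionTree.meanHittingTime (SubdivisionTree.graph m T t) ≠ ⊤ ∧
      (SubdivisionTree.meanHittingTime (SubdivisionTree.graph m T t)).toReal =
        2 / (Fintype.card (SubdivisionTree.Vert m T t) : ℝ) *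
          (SubdivisionTree.f₁ m ^ t * SubdivisionTree.wienerIndex T
            - SubdivisionTree.g₁ m * ∑ i ∈ Finset.range t, SubdivisionTree.f₁ m ^ i *
                (Fintype.card (SubdivisionTree.Vert m T (t - 1 - i)) : ℝ) ^ 2
            + SubdivisionTree.h₁ m * ∑ i ∈ Finset.range t, SubdivisionTree.f₁ m ^ i *
                (Fintype.card (SubdivisionTree.Vert m T (t - 1 - i)) : ℝ)
            - SubdivisionTree.l₁ m * ∑ i ∈ Finset.range t, SubdivisionTree.f₁ m ^ i)) := by
  subst hn
  refine ⟨SubdivisionTree.card_vert hT m t, fun hn => ?_⟩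
  rw [← SubdivisionTree.wienerIndex_graph hT m t]
  exact SubdivisionTree.meanHittingTime_of_isTree (SubdivisionTree.isTree_graph hT m t)
    (SubdivisionTree.two_le_card_vert hT m t hn)
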